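/- Let $n\ge 5$ and consider the two-facility game on the line with agents $1,\dots,n$. An instance is a profile $\mathbf{x}=(x_1,\dots,x_n)\in\mathbb{R}^n$ of agent locations, and a deterministic mechanism is a function $f:\mathbb{R}^n\to\mathbb{R}^2$; for $f(\mathbf{x})=(l_1,l_2)$ the facilities are placed at $l_1$ and $l_2$. An agent at $y$ has cost $\mathrm{cost}(\{l_1,l_2\},y)=\min\{|l_1-y|,|l_2-y|\}$. The mechanism $f$ is strategy-proof if $\mathrm{cost}(f(x_i,\mathbf{x}_{-i}),x_i)\le \mathrm{cost}(f(x_i',\mathbf{x}_{-i}),x_i)$ for every $\mathbf{x}\in\mathbb{R}^n$, every agent $i$ and every $x_i'\in\mathbb{R}$, where $(x_i',\mathbf{x}_{-i})$ is $\mathbf{x}$ with its $i$-th entry replaced by $x_i'$. It has bounded approximation ratio if there is a constant $\gamma\in\mathbb{R}$ with $\sum_{i=1}^n \mathrm{cost}(f(\mathbf{x}),x_i)\le \gamma\cdot \inf_{a,b\in\mathbb{R}}\sum_{i=1}^n \mathrm{cost}(\{a,b\},x_i)$ for every $\mathbf{x}\in\mathbb{R}^n$. Theorem 1. Let $f$ be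 a deterministic, strategy-proof mechanism with bounded approximation ratio for the two-facility game on the line with $n\ge 5$ agents. Then for every instance $\mathbf{x}$, with facilities $l_1,l_2$ of $f(\mathbf{x})$, either some $l\in\{l_1,l_2\}$ satisfies $l\ge\max\mathbf{x}$ or $l\le\min\mathbf{x}$, or $l_1=l_2$. Moreover, if agent $j$ is a dictator of $f$, that is, $f$ places a facility at $x_j$ on every instance $\mathbf{x}$, then on every instance $\mathbf{x}$ the second facility $l_2$ (so that the set of facility locations is $\{x_j,l_2\}$) satisfies $l_2\le\min\mathbf{x}$, or $l_2\ge\max\mathbf{x}$, or $l_2=x_j$. -/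

import Mathlib

namespace TwoFacility

/-- A location profile (instance): the reported locations of the `n` agents on the line. -/
abbrev Profile (n : ℕ) : Type := Fin n → ℝ

/-- A deterministic mechanism maps every location profile to two facility locations. -/
abbrev Mechanism (n : ℕ) : Type := Profile n → ℝ × ℝ

/-- The set `{l₁, l₂}` of facility locations of an output `(l₁, l₂)`. -/
def facilities (p : ℝ × ℝ) : Set ℝ := {p.1, p.2}

/-- The cost of an agent located at `y`: the distance to the nearest facility. -/
noncomputable def cost (p : ℝ × ℝ) (y : ℝ) : ℝ := min (dist p.1 y) (dist p.2 y)

/-- The social cost of placing the facilities at `p` when the agents are located at `x`. -/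
noncomputable def socialCost {n : ℕ} (p : ℝ × ℝ) (x : Profile n) : ℝ := ∑ i, cost p (x i)

/-- The optimal social cost over all placements of two facilities. -/
noncomputable def OPT {n : ℕ} (x : Profile n) : ℝ := ⨅ p : ℝ × ℝ, socialCost p x

/-- No agent can reduce her cost by misreporting a location `y` instead of her location `x i`. -/
def IsStrategyProof {n : ℕ} (f : Mechanism n) : Prop :=
  ∀ (x : Profile n) (i : Fin n) (y : ℝ),
    cost (f x) (x i) ≤ cost (f (Function.update x i y)) (x i)

/-- The approximation ratio of `f` for the social cost is bounded by a finite constant. -/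
def HasBoundedRatio {n : ℕ} (f : Mechanism n) : Prop :=
  ∃ γ : ℝ, ∀ x : Profile n, socialCost (f x) x ≤ γ * OPT x

/-- Nice mechanisms: (deterministic,) strategy-proof, with bounded approximation ratio. -/
structure IsNice {n : ℕ} (f : Mechanism n) : Prop where
  strategyProof : IsStrategyProof f
  boundedRatio : HasBoundedRatio f

/-- Agent `j` is a dictator: on every instance a facility is placed at her reported location. -/
def IsDictator {n : ℕ} (f : Mechanism n) (j : Fin n) : Prop :=
  ∀ x : Profile n, x j ∈ facilities (f x)

end TwoFacility

/-! Strategy-proofness says that an agent, or a group reporting one common location, is served from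
the nearest point of the menu of locations it can obtain. Suppose a facility `l` lies strictly
between agents `i` and `k`. Everybody else may move to `l` without displacing it, which leaves a
three-group instance in which the middle group wins.

Three-group instances are rigid: one win of the middle group forces it to win in every instance with
the same left-to-right order (`IsNice₃.wins_of_middleWins`), and forbids either outer group from
ever winning in the middle with the opposite outer group on its own side
(`IsNice₃.not_middleWins_swapLast` and its mirror image). If both could win, two nearby groups would
take both facilities and leave the distant third one unserved, against the bounded ratio.

A winning middle group can be split: one part still wins after the other part joins its outer
neighbour (`GroupWins.split`, by a contradiction among four groups). Repeated splitting produces a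
pivot `j` such that nothing can win between `i` and `j`, nor between `j` and `k` (`exists_pivot`).
For two facilities `l < r` strictly between `i` and `k`, either `j` lies to the right of `l`, and
`l` wins between `i` and `j`, or `r` wins between `j` and `k`; both are excluded. For a dictator, a
second facility strictly between her and another agent would win everywhere, and would leave a far
agent unserved. -/

namespace TwoFacility

/-! ### Menus of a single agent -/

/-- `y` is a location available to an agent reporting `x` that is, among all locations which she can
obtain by some report, nearest to `x`. -/
def Best (Φ : ℝ → ℝ → Prop) (x y : ℝ) : Prop :=
  Φ x y ∧ ∀ x' z, Φ x' z → |x - y| ≤ |x - z|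

/-- Strategy-proofness for a single agent, the other reports being fixed. -/
def HasBest (Φ : ℝ → ℝ → Prop) : Prop := ∀ x, ∃ y, Best Φ x y

theorem HasBest.win {Φ : ℝ → ℝ → Prop} (h : HasBest Φ) {x z : ℝ} (hz : Φ x z) : Φ z z := by
  obtain ⟨y, hy, hm⟩ := h z
  have := hm x z hz
  rw [sub_self, abs_zero] at this
  have : z = y := sub_eq_zero.1 (abs_nonpos_iff.1 this)
  rwa [← this] at hy

/-- By the triangle inequality, a menu point nearer to `x'` than `y` would also be nearer to `x`. -/
theorem HasBest.pull_right {Φ : ℝ → ℝ → Prop} (h : HasBest Φ) {x y x' : ℝ} (hb : Best Φ x y)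
    (h1 : x ≤ x') (h2 : x' ≤ y) : Best Φ x' y := by
  rcases eq_or_lt_of_le h1 with rfl | h1
  · exact hb
  obtain ⟨w, hw, hm⟩ := h x'
  have e1 := hm x y hb.1
  have e2 := hb.2 x' w hw
  have : w = y := by
    rw [abs_of_nonpos (by linarith)] at e2
    rw [abs_of_nonpos (by linarith : x' - y ≤ 0)] at e1
    rw [abs_le] at e1
    rcases le_total x w with h3 | h3
    · rw [abs_of_nonpos (by linarith)] at e2
      linarith
    · rw [abs_of_nonneg (by linarith)] at e2
      linarith
  rw [this] at hw hm
  exact ⟨hw, hm⟩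

/-- The image of `Φ` under the reflection of the line. -/
def reflect (Φ : ℝ → ℝ → Prop) (x y : ℝ) : Prop := Φ (-x) (-y)

theorem abs_neg_sub_neg' (s t : ℝ) : |-s - -t| = |s - t| := by
  rw [← abs_neg]
  congr 1
  ring

theorem best_reflect {Φ : ℝ → ℝ → Prop} {x y : ℝ} : Best (reflect Φ) x y ↔ Best Φ (-x) (-y) := by
  have e := abs_neg_sub_neg'
  constructor
  · rintro ⟨h1, h2⟩
    refine ⟨h1, fun x' z hz => ?_⟩
    have := h2 (-x') (-z) (by simpa [reflect] using hz)
    rw [← e x y, ← e x (-z), neg_neg] at this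
    exact this
  · rintro ⟨h1, h2⟩
    refine ⟨h1, fun x' z hz => ?_⟩
    have := h2 (-x') (-z) hz
    rwa [e, e] at this

theorem HasBest.reflect {Φ : ℝ → ℝ → Prop} (h : HasBest Φ) : HasBest (reflect Φ) := fun x => by
  obtain ⟨y, hy⟩ := h (-x)
  exact ⟨-y, best_reflect.2 (by rwa [neg_neg])⟩

theorem HasBest.pull_left {Φ : ℝ → ℝ → Prop} (h : HasBest Φ) {x y x' : ℝ} (hb : Best Φ x y)
    (h1 : x' ≤ x) (h2 : y ≤ x') : Best Φ x' y := by
  have := h.reflect.pull_right (x := -x) (y := -y) (x' := -x')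
    (best_reflect.2 (by simpa using hb)) (by linarith) (by linarith)
  simpa using best_reflect.1 this

/-- If nobody in `[x, z]` is best served from the right and `z` is available, so is `x`. -/
theorem HasBest.available_left {Φ : ℝ → ℝ → Prop} (h : HasBest Φ) {x z : ℝ} (hxz : x ≤ z)
    (hz : Φ z z) (hl : ∀ y, x ≤ y → y ≤ z → ∀ l, Best Φ y l → l ≤ y) : Φ x x := by
  by_contra hx
  set S : Set ℝ := {w | Φ w w ∧ x ≤ w} with hS
  have hne : S.Nonempty := ⟨z, hz, hxz⟩
  have hbd : BddBelow S := ⟨x, fun w hw => hw.2⟩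
  set s := sInf S with hs
  have hxs : x ≤ s := le_csInf hne fun w hw => hw.2
  have hsz : s ≤ z := csInf_le hbd ⟨hz, hxz⟩
  -- The midpoint of the gap below `s` is best served from the left of `x`, hence from farther away
  -- than `s`, although available points accumulate at `s` or include it.
  obtain ⟨l, hl1, hl2⟩ := h ((x + s) / 2)
  have hle := hl _ (by linarith) (by linarith) l ⟨hl1, hl2⟩
  have hll : Φ l l := h.win hl1
  have hlx : l < x := by
    by_contra hc
    push Not at hc
    have h1 : s ≤ l := csInf_le hbd ⟨hll, hc⟩
    have : l = x := by linarith
    exact hx (this ▸ hll)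
  have hd : (x + s) / 2 - l ≤ s - (x + s) / 2 := by
    refine le_of_forall_pos_le_add fun ε hε => ?_
    obtain ⟨w, hw, hws⟩ := exists_lt_of_csInf_lt hne (show sInf S < s + ε by linarith)
    have h1 := hl2 w w hw.1
    have h2 : s ≤ w := csInf_le hbd hw
    rw [abs_of_nonneg (by linarith), abs_of_nonpos (by linarith)] at h1
    linarith
  linarith

theorem HasBest.available_right {Φ : ℝ → ℝ → Prop} (h : HasBest Φ) {x z : ℝ} (hxz : z ≤ x)
    (hz : Φ z z) (hl : ∀ y, z ≤ y → y ≤ x → ∀ l, Best Φ y l → y ≤ l) : Φ x x := by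
  have := h.reflect.available_left (x := -x) (z := -z) (by linarith)
    (by simpa [TwoFacility.reflect] using hz)
    (fun y h1 h2 l hb => by
      have := hl (-y) (by linarith) (by linarith) (-l) (best_reflect.1 hb)
      linarith)
  simpa [TwoFacility.reflect] using this

/-! ### Two agents to the right of a fixed point -/

/-- Two agents `u < c` to the right of `t`. If `u` wins once while also serving `c` best, then every
agent at or to the right of `u` wins against everyone to her right. -/
theorem wins_of_wins {G : ℝ → ℝ → ℝ → Prop} {t κ : ℝ} (hκ : 0 < κ)
    (hU : ∀ c, HasBest fun u => G u c) (hC : ∀ u, HasBest (G u))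
    (two : ∀ {u c x y z}, G u c x → G u c y → G u c z → x = y ∨ x = z ∨ y = z)
    (diag : ∀ {u}, t < u → G u u u)
    (left : ∀ {u c}, t < u → u < c → ∃ y, y ≤ u ∧ G u c y)
    (near : ∀ {u c}, t < u → u < c → c - u < κ * (u - t) → ∃ y, G u c y ∧ y < 2 * u - c)
    {u₀ c₀ : ℝ} (h₀ : t < u₀) (h₁ : u₀ < c₀) (hb : Best (G u₀) c₀ u₀) :
    ∀ u c, u₀ ≤ u → u < c → G u c u := by
  -- in a near instance `u` and `c` share a facility between them
  have share : ∀ {u c}, t < u → u < c → c - u < κ * (u - t) → ∀ l m, Best (G u) c l →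
      Best (fun x => G x c) u m → l = m ∧ u ≤ l ∧ l ≤ c := by
    intro u c h1 h2 h3 l m hl hm
    -- This facility is farther than `c - u` from both agents, and each gets within `c - u` by
    -- imitating the other; so the one other facility serves both.
    obtain ⟨y, hy, hyl⟩ := near h1 h2 h3
    have a1 := hl.2 u u (diag h1)
    have a2 := hm.2 c c (diag (h1.trans h2))
    rw [abs_of_pos (by linarith : 0 < c - u), abs_le] at a1
    rw [abs_of_neg (by linarith : u - c < 0), abs_le] at a2
    rcases two hy hl.1 hm.1 with e | e | e
    · linarith
    · linarith
    · subst e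
      exact ⟨rfl, by linarith, by linarith⟩
  -- If the shared facility were some `l > u`, the points just right of `u` would be on the menu of
  -- the right agent, and at `c'` she would prefer one of them to `u`.
  have step0 : ∀ u c', t < u → u < c' → Best (G u) c' u →
      ∀ c, u < c → c - u < κ * (u - t) → Best (G u) c u := by
    intro u c' hu huc' hbu c huc hc
    obtain ⟨l, hl⟩ := hC u c
    obtain ⟨m, hm⟩ := hU c u
    obtain ⟨-, hul, hlc⟩ := share hu huc hc l m hl hm
    rcases eq_or_lt_of_le hul with e | hlt
    · rwa [← e] at hl
    exfalso
    have hx1 : u < min l c' := lt_min hlt huc'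
    have hx := (hC u).available_left (min_le_left l c') ((hC u).win hl.1) (by
      intro y hy1 hy2 l' hl'
      obtain ⟨m', hm'⟩ := hU y u
      exact (share hu (by linarith) (by linarith) l' m' hl' hm').2.2)
    have := hbu.2 _ _ hx
    rw [abs_of_pos (by linarith), abs_of_nonneg (by linarith [min_le_right l c'])] at this
    linarith
  set S : ℝ → Prop := fun u => ∃ c, u < c ∧ Best (G u) c u with hS
  have step1 : ∀ u, t < u → S u → ∀ u', u ≤ u' → u' - u < κ * (u - t) / 2 → S u' := by
    rintro u hu ⟨c', hc', hbu⟩ u' huu' hu'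
    have hpos : 0 < κ * (u - t) := mul_pos hκ (by linarith)
    set c := u + κ * (u - t) / 2 with hc
    have hw := (step0 u c' hu hc' hbu c (by linarith) (by linarith)).1
    have hmono : ∀ y, u ≤ y → κ * (u - t) ≤ κ * (y - t) := fun y hy =>
      mul_le_mul_of_nonneg_left (by linarith) hκ.le
    have hw' := (hU c).available_right huu' hw (by
      intro y hy1 hy2 m hm
      obtain ⟨l, hl⟩ := hC y c
      obtain ⟨e, h1, -⟩ := share (by linarith) (by linarith)
        (by linarith [hmono y hy1]) l m hl hm
      rwa [← e])
    obtain ⟨l, hl⟩ := hC u' c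
    have hm : Best (fun x => G x c) u' u' := ⟨hw', fun _ _ _ => by simp⟩
    obtain ⟨e, -, -⟩ := share (by linarith) (by linarith)
        (by linarith [hmono u' huu']) l u' hl hm
    exact ⟨c, by linarith, e ▸ hl⟩
  -- The admissible move in `step1` is proportional to `u - t`, so the distance from `t` can grow
  -- geometrically.
  have hpow : ∀ n : ℕ, ∀ u, u₀ ≤ u → u - t ≤ (1 + κ / 4) ^ n * (u₀ - t) → S u := by
    intro n
    induction n with
    | zero =>
      intro u hu h
      have : u = u₀ := by
        simp at h
        linarith
      rw [this]
      exact ⟨c₀, h₁, hb⟩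
    | succ n ih =>
      intro u hu h
      rcases le_total (u - t) ((1 + κ / 4) ^ n * (u₀ - t)) with h' | h'
      · exact ih u hu h'
      have hge : u₀ - t ≤ (1 + κ / 4) ^ n * (u₀ - t) :=
        le_mul_of_one_le_left (by linarith) (one_le_pow₀ (by linarith))
      set v := (1 + κ / 4) ^ n * (u₀ - t) with hv
      have hvpos : 0 < κ * v := mul_pos hκ (by linarith)
      have h2 : u - t ≤ v + κ * v / 4 := by
        rw [pow_succ] at h
        calc u - t ≤ _ := h
          _ = v + κ * v / 4 := by rw [hv]; ring
      refine step1 (t + v) (by linarith) (ih _ (by linarith) (by linarith)) u (by linarith) ?_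
      have : t + v - t = v := by ring
      rw [this]
      linarith
  have hall : ∀ u, u₀ ≤ u → S u := by
    intro u hu
    obtain ⟨n, hn⟩ := pow_unbounded_of_one_lt ((u - t) / (u₀ - t)) (by linarith : 1 < 1 + κ / 4)
    rw [div_lt_iff₀ (by linarith)] at hn
    exact hpow n u hu hn.le
  intro u c hu huc
  refine (hU c).available_left huc.le (diag (by linarith)) ?_
  intro y hy1 hy2 l hl
  by_contra hyl
  push Not at hyl
  have hyc : y < c := by
    rcases eq_or_lt_of_le hy2 with rfl | h
    · have := hl.2 y y (diag (by linarith))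
      rw [sub_self, abs_zero] at this
      have := sub_eq_zero.1 (abs_nonpos_iff.1 this)
      linarith
    · exact h
  have hlc : l ≤ c := by
    have := hl.2 c c (diag (by linarith))
    rw [abs_of_neg (by linarith), abs_of_neg (by linarith)] at this
    linarith
  -- a near instance `w < l` in which both are served
  obtain ⟨w, hw1, hw2, hw3⟩ : ∃ w, y ≤ w ∧ w < l ∧ l - w < κ * (w - t) := by
    have hpos : 0 < κ * (y - t) := mul_pos hκ (by linarith)
    refine ⟨max y (l - κ * (y - t) / 2), le_max_left _ _, max_lt hyl (by linarith), ?_⟩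
    have h1 := le_max_left y (l - κ * (y - t) / 2)
    have h2 := le_max_right y (l - κ * (y - t) / 2)
    have : κ * (y - t) ≤ κ * (max y (l - κ * (y - t) / 2) - t) :=
      mul_le_mul_of_nonneg_left (by linarith) hκ.le
    linarith
  have hwl := (hU c).pull_right hl hw1 hw2.le
  have hnw : ¬ G w c w := fun h => by
    have := hwl.2 w w h
    rw [sub_self, abs_zero] at this
    have := sub_eq_zero.1 (abs_nonpos_iff.1 this)
    linarith
  obtain ⟨y', hy', hy'G⟩ := left (by linarith : t < w) (by linarith : w < c)
  obtain ⟨m, hm⟩ := hC w c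
  have hmw : w ≤ m := by
    have := hm.2 w w (diag (by linarith))
    rw [abs_of_pos (by linarith : 0 < c - w), abs_le] at this
    linarith
  have hml : m = l := by
    rcases two hy'G hm.1 hwl.1 with e | e | e
    · exact absurd ((by linarith : y' = w) ▸ hy'G) hnw
    · linarith
    · exact e
  rw [hml] at hm
  -- Moving `c` down to `l` keeps `l` best for her, whereas `step0` makes `w` best at the near
  -- location `l`.
  have hlast := (hC w).pull_left hm hlc le_rfl
  obtain ⟨c', hc', hbw⟩ := hall w (by linarith)
  have hww := (step0 w c' (by linarith) hc' hbw l hw2 hw3).2 _ _ hlast.1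
  rw [sub_self, abs_zero] at hww
  have := sub_eq_zero.1 (abs_nonpos_iff.1 hww)
  linarith

/-! ### Three agents -/

/-- A strategy-proof mechanism for three agents with bounded approximation ratio, as the relation
`F a b c y`: there is a facility at `y` when the agents report `a`, `b`, `c`. -/
structure IsNice₃ (F : ℝ → ℝ → ℝ → ℝ → Prop) (K : ℝ) : Prop where
  nonneg : 0 ≤ K
  sp₁ : ∀ b c, HasBest fun x => F x b c
  sp₂ : ∀ a c, HasBest fun x => F a x c
  sp₃ : ∀ a b, HasBest (F a b)
  two : ∀ {a b c x y z}, F a b c x → F a b c y → F a b c z → x = y ∨ x = z ∨ y = z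
  ratio : ∀ a b c z, z = a ∨ z = b ∨ z = c →
    ∃ y, F a b c y ∧ |z - y| ≤ K * |a - b| ∧ |z - y| ≤ K * |b - c| ∧ |z - y| ≤ K * |a - c|

/-- In some instance ordered as `a < b < c` the middle agent gets a facility. -/
def MiddleWins (F : ℝ → ℝ → ℝ → ℝ → Prop) : Prop :=
  ∃ a b c, a < b ∧ b < c ∧ F a b c b

def reflect₃ (F : ℝ → ℝ → ℝ → ℝ → Prop) (a b c y : ℝ) : Prop := F (-c) (-b) (-a) (-y)

/-- Under this swap `MiddleWins` concerns the third agent, placed between the first and the second.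
-/
def swapLast (F : ℝ → ℝ → ℝ → ℝ → Prop) (a b c y : ℝ) : Prop := F a c b y

def swapFirst (F : ℝ → ℝ → ℝ → ℝ → Prop) (a b c y : ℝ) : Prop := F b a c y

variable {F : ℝ → ℝ → ℝ → ℝ → Prop} {K : ℝ}

theorem middleWins_reflect₃ (h : MiddleWins F) : MiddleWins (reflect₃ F) := by
  obtain ⟨a, b, c, hab, hbc, h⟩ := h
  exact ⟨-c, -b, -a, by linarith, by linarith, by simpa [reflect₃] using h⟩

namespace IsNice₃

theorem swapLast (h : IsNice₃ F K) : IsNice₃ (swapLast F) K where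
  nonneg := h.nonneg
  sp₁ b c := h.sp₁ c b
  sp₂ a c := h.sp₃ a c
  sp₃ a b := h.sp₂ a b
  two := h.two
  ratio a b c z hz := by
    obtain ⟨y, hy, h1, h2, h3⟩ := h.ratio a c b z (by tauto)
    exact ⟨y, hy, h3, by rwa [abs_sub_comm b c], h1⟩

theorem reflect₃ (h : IsNice₃ F K) : IsNice₃ (reflect₃ F) K where
  nonneg := h.nonneg
  sp₁ b c := (h.sp₃ (-c) (-b)).reflect
  sp₂ a c := (h.sp₂ (-c) (-a)).reflect
  sp₃ a b := (h.sp₁ (-b) (-a)).reflect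
  two hx hy hz := by
    have := h.two hx hy hz
    simpa [neg_inj] using this
  ratio a b c z hz := by
    obtain ⟨y, hy, h1, h2, h3⟩ := h.ratio (-c) (-b) (-a) (-z) (by
      rcases hz with rfl | rfl | rfl <;> simp)
    refine ⟨-y, by simpa [TwoFacility.reflect₃] using hy, ?_, ?_, ?_⟩ <;>
      rw [← abs_neg_sub_neg' z, neg_neg]
    · rwa [abs_neg_sub_neg', abs_sub_comm b a] at h2
    · rwa [abs_neg_sub_neg', abs_sub_comm c b] at h1
    · rwa [abs_neg_sub_neg', abs_sub_comm c a] at h3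

variable (h : IsNice₃ F K)
include h

theorem eq_of_ratio_zero {a b c z : ℝ} (hz : z = a ∨ z = b ∨ z = c)
    (h0 : a = b ∨ b = c ∨ a = c) : F a b c z := by
  obtain ⟨y, hy, h1, h2, h3⟩ := h.ratio a b c z hz
  have : |z - y| ≤ 0 := by
    rcases h0 with rfl | rfl | rfl
    · simpa using h1
    · simpa using h2
    · simpa using h3
  rwa [sub_eq_zero.1 (abs_nonpos_iff.1 this)]

theorem le_of_best₁ {a b c y : ℝ} (hab : a < b) (hy : Best (fun x => F x b c) a y) : y ≤ b := by
  have := hy.2 b b (h.eq_of_ratio_zero (by simp) (by simp))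
  rw [abs_of_neg (by linarith : a - b < 0), abs_le] at this
  linarith

theorem le_of_best₃ {a b c y : ℝ} (hbc : b < c) (hy : Best (F a b) c y) : b ≤ y := by
  have := hy.2 b b (h.eq_of_ratio_zero (by simp) (by simp))
  rw [abs_of_pos (by linarith : 0 < c - b), abs_le] at this
  linarith

/-- The bounded ratio keeps one facility near `a`, left of `b`; the other is at `b` and must serve
`c`. -/
theorem best₃_of_close {a b c : ℝ} (hbc : b < c) (hc : K * (c - b) < b - a)
    (hw : F a b c b) : Best (F a b) c b := by
  obtain ⟨l, hl⟩ := h.sp₃ a b c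
  have hbl := h.le_of_best₃ hbc hl
  obtain ⟨y, hy, -, h2, -⟩ := h.ratio a b c a (by simp)
  rw [abs_of_neg (by linarith : b - c < 0), abs_le] at h2
  rcases h.two hy hw hl.1 with e | e | e
  · linarith
  · linarith
  · rwa [← e] at hl

theorem wins_right {a b₀ c₀ : ℝ} (hab : a < b₀) (hbc : b₀ < c₀) (hb : Best (F a b₀) c₀ b₀) :
    ∀ b c, b₀ ≤ b → b < c → F a b c b := by
  have hK := h.nonneg
  -- With this `κ`, nearness means `(K + 1) * (c - u) < u - a`, so the facility within `K * (c - u)`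
  -- of `a` is left of `2 * u - c`.
  refine wins_of_wins (G := F a) (t := a) (κ := 1 / (K + 1)) (by positivity) (h.sp₂ a) (h.sp₃ a)
    h.two (fun _ => h.eq_of_ratio_zero (by simp) (by simp)) ?_ ?_ hab hbc hb
  · intro u c h1 h2
    obtain ⟨y, hy⟩ := h.sp₁ u c a
    exact ⟨y, h.le_of_best₁ h1 hy, hy.1⟩
  · intro u c h1 h2 h3
    obtain ⟨y, hy, -, h4, -⟩ := h.ratio a u c a (by simp)
    refine ⟨y, hy, ?_⟩
    rw [abs_of_neg (by linarith : u - c < 0), abs_le] at h4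
    rw [div_mul_eq_mul_div, one_mul, lt_div_iff₀ (by linarith)] at h3
    linarith

theorem wins_left {a₀ b₀ c : ℝ} (hab : a₀ < b₀) (hbc : b₀ < c)
    (hb : Best (fun x => F x b₀ c) a₀ b₀) : ∀ a b, b ≤ b₀ → a < b → F a b c b := by
  intro a b h1 h2
  have := h.reflect₃.wins_right (a := -c) (b₀ := -b₀) (c₀ := -a₀) (by linarith) (by linarith)
    (by
      have := (best_reflect (Φ := fun x => F x b₀ c) (x := -a₀) (y := -b₀)).2 (by simpa using hb)
      simpa [Best, reflect, TwoFacility.reflect₃] using this) (-b) (-a) (by linarith) (by linarith)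
  simpa [TwoFacility.reflect₃] using this

/-- The best facility of `a` is at most `b`, that of `c` at least `b`; with `b` itself, two of the
three coincide. -/
theorem best₁_or_best₃ {a b c : ℝ} (hab : a < b) (hbc : b < c) (hw : F a b c b) :
    Best (fun x => F x b c) a b ∨ Best (F a b) c b := by
  obtain ⟨l, hl⟩ := h.sp₁ b c a
  obtain ⟨r, hr⟩ := h.sp₃ a b c
  have h1 := h.le_of_best₁ hab hl
  have h2 := h.le_of_best₃ hbc hr
  rcases h.two hw hl.1 hr.1 with e | e | e
  · left; rwa [← e] at hl
  · right; rwa [← e] at hr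
  · left
    have : l = b := by linarith
    rwa [this] at hl

/-- First `wins_left` sends `a` far away; then `b₀` and `c₀` are relatively close, and `wins_right`
applies. -/
theorem exists_wins_right_of_best₁ {a₀ b₀ c₀ : ℝ} (hab : a₀ < b₀) (hbc : b₀ < c₀)
    (hb : Best (fun x => F x b₀ c₀) a₀ b₀) :
    ∃ A, ∀ a < A, ∀ b c, b₀ ≤ b → b < c → F a b c b := by
  have hK := h.nonneg
  refine ⟨b₀ - K * (c₀ - b₀), fun a ha => ?_⟩
  have h1 : 0 ≤ K * (c₀ - b₀) := mul_nonneg hK (by linarith)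
  exact h.wins_right (by linarith) hbc (h.best₃_of_close hbc (by linarith)
    (h.wins_left hab hbc hb a b₀ le_rfl (by linarith)))

theorem best₁_of_close {a b c : ℝ} (hab : a < b) (hc : K * (b - a) < c - b)
    (hw : F a b c b) : Best (fun x => F x b c) a b := by
  obtain ⟨l, hl⟩ := h.sp₁ b c a
  have hbl := h.le_of_best₁ hab hl
  obtain ⟨y, hy, h2, -, -⟩ := h.ratio a b c c (by simp)
  rw [abs_of_neg (by linarith : a - b < 0), abs_le] at h2
  rcases h.two hy hw hl.1 with e | e | e
  · linarith
  · linarith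
  · rwa [← e] at hl

theorem exists_wins_right (hw : MiddleWins F) :
    ∃ A b₀, ∀ a < A, ∀ b c, b₀ ≤ b → b < c → F a b c b := by
  obtain ⟨a, b, c, hab, hbc, hF⟩ := hw
  rcases h.best₁_or_best₃ hab hbc hF with hb | hb
  · obtain ⟨A, hA⟩ := h.exists_wins_right_of_best₁ hab hbc hb
    exact ⟨A, b, hA⟩
  · have h1 : 0 ≤ K * (b - a) := mul_nonneg h.nonneg (by linarith)
    have hc' : b < b + K * (b - a) + 1 := by linarith
    obtain ⟨A, hA⟩ := h.exists_wins_right_of_best₁ hab hc'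
      (h.best₁_of_close hab (by linarith) (h.wins_right hab hbc hb b _ le_rfl hc'))
    exact ⟨A, b, hA⟩

/-- Two agents cannot both win in the middle against each other, to the right of the third. -/
theorem not_middleWins_swapLast (hw : MiddleWins F) : ¬ MiddleWins (TwoFacility.swapLast F) := by
  intro hw'
  obtain ⟨A, b₁, hA⟩ := h.exists_wins_right hw
  obtain ⟨A', b₂, hA'⟩ := h.swapLast.exists_wins_right hw'
  have hK := h.nonneg
  obtain ⟨a, ha1, ha2⟩ : ∃ a, a < A ∧ a < A' := ⟨min A A' - 1, by
    linarith [min_le_left A A'], by linarith [min_le_right A A']⟩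
  obtain ⟨β, hβ1, hβ2, hβ3⟩ : ∃ β, b₁ ≤ β ∧ b₂ ≤ β ∧ a < β :=
    ⟨max (max b₁ b₂) (a + 1), by simp, by simp, by simp⟩
  have hW : ∀ b c, β ≤ b → b < c → F a b c b := fun b c hb hc => hA a ha1 b c (by linarith) hc
  have hW' : ∀ b c, β ≤ c → c < b → F a b c c := fun b c hb hc => hA' a ha2 c b (by linarith) hc
  have far : ∀ u v, β ≤ u → u < v → F a u v v → u - a ≤ K * (v - u) := by
    intro u v hu huv hF
    obtain ⟨y, hy, -, h2, -⟩ := h.ratio a u v a (by simp)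
    rw [abs_of_neg (by linarith : u - v < 0), abs_le] at h2
    rcases h.two hy (hW u v hu huv) hF with e | e | e <;> linarith
  have far' : ∀ u v, β ≤ v → v < u → F a u v u → v - a ≤ K * (u - v) := by
    intro u v hv huv hF
    obtain ⟨y, hy, -, h2, -⟩ := h.ratio a u v a (by simp)
    rw [abs_of_pos (by linarith : 0 < u - v), abs_le] at h2
    rcases h.two hy (hW' u v hv huv) hF with e | e | e <;> linarith
  -- the right agent is never best served from her right
  have hleft : ∀ c l, β < c → Best (F a β) c l → l ≤ c := by
    intro c l hc hl
    by_contra hlc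
    push Not at hlc
    set η := min (l - c) ((β - a) / (K + 1)) with hη
    have hη0 : 0 < η := lt_min (by linarith) (div_pos (by linarith) (by linarith))
    have hη1 : η ≤ l - c := min_le_left _ _
    have hη2 : η * (K + 1) ≤ β - a := by
      rw [← le_div_iff₀ (by linarith)]
      exact min_le_right _ _
    -- The third agent approaches `l`, then the second jumps to `l`: both win at distance `η`, too
    -- small for `far'`.
    have h1 := (h.sp₃ a β).pull_right hl (x' := l - η) (by linarith) (by linarith)
    have h2 : F a l (l - η) l := (h.sp₂ a (l - η)).win h1.1
    have h3 := far' l (l - η) (by linarith) (by linarith) h2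
    have : l - (l - η) = η := by ring
    rw [this] at h3
    linarith
  have hpos : 0 ≤ K * (β - a) := mul_nonneg hK (by linarith)
  obtain ⟨z, hz, hzF⟩ : ∃ z, β < z ∧ F a β z z := by
    obtain ⟨y, hy, h1, -, -⟩ := h.ratio a β (β + K * (β - a) + 1) (β + K * (β - a) + 1) (by simp)
    rw [abs_of_neg (by linarith : a - β < 0), abs_le] at h1
    exact ⟨y, by linarith, (h.sp₃ a β).win hy⟩
  set η := min (z - β) ((β - a) / (K + 1)) with hη
  have hη0 : 0 < η := lt_min (by linarith) (div_pos (by linarith) (by linarith))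
  have hη1 : η ≤ z - β := min_le_left _ _
  have hη2 : η * (K + 1) ≤ β - a := by
    rw [← le_div_iff₀ (by linarith)]
    exact min_le_right _ _
  have h1 := (h.sp₃ a β).available_left (x := β + η) (by linarith) hzF
    fun y hy1 _ l hl => hleft y l (by linarith) hl
  have h2 := far β (β + η) le_rfl (by linarith) h1
  have : β + η - β = η := by ring
  rw [this] at h2
  linarith

theorem not_middleWins_swapFirst (hw : MiddleWins F) : ¬ MiddleWins (TwoFacility.swapFirst F) := by
  intro hw'
  refine h.reflect₃.not_middleWins_swapLast (middleWins_reflect₃ hw) ?_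
  obtain ⟨a, b, c, hab, hbc, hF⟩ := hw'
  exact ⟨-c, -b, -a, by linarith, by linarith, by
    simpa [TwoFacility.reflect₃, TwoFacility.swapLast, TwoFacility.swapFirst] using hF⟩

/-- If `y` were strictly between `a` and `b`, the third agent could move to `y` and win in the
middle; between `b` and `c`, the first agent could. -/
theorem outside_of_middleWins (hw : MiddleWins F) {a b c y : ℝ}
    (hy : F a b c y) : y ≤ a ∨ y = b ∨ c ≤ y := by
  by_contra! hc
  obtain ⟨h1, h2, h3⟩ := hc
  rcases lt_or_gt_of_ne h2 with h4 | h4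
  · exact h.not_middleWins_swapLast hw ⟨a, y, b, h1, h4, (h.sp₃ a b).win hy⟩
  · exact h.not_middleWins_swapFirst hw ⟨b, y, c, h4, h3, (h.sp₁ b c).win hy⟩

omit h in
theorem forall_of_local {P : ℝ → Prop} {u v m : ℝ} (hm : 0 < m)
    (hP : ∀ y y', u ≤ y → y ≤ v → u ≤ y' → y' ≤ v → |y' - y| < m → P y → P y') {x z : ℝ}
    (hx1 : u ≤ x) (hx2 : x ≤ v) (hz1 : u ≤ z) (hz2 : z ≤ v) (hx : P x) : P z := by
  obtain ⟨n, hn⟩ := exists_nat_gt (|z - x| / m)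
  have hn0 : (0 : ℝ) < n := lt_of_le_of_lt (by positivity) hn
  rw [div_lt_iff₀ hm] at hn
  have mem : ∀ s : ℝ, 0 ≤ s → s ≤ 1 → u ≤ x + s * (z - x) ∧ x + s * (z - x) ≤ v := by
    intro s h0 h1
    have e : x + s * (z - x) = (1 - s) * x + s * z := by ring
    rw [e]
    constructor <;> nlinarith
  have key : ∀ k : ℕ, k ≤ n → P (x + k / n * (z - x)) := by
    intro k
    induction k with
    | zero => intro _; simpa using hx
    | succ k ih =>
      intro hk
      have hk' : ((k : ℝ) + 1) ≤ n := by exact_mod_cast hk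
      have a1 := mem (k / n) (by positivity) ((div_le_one hn0).2 (by linarith))
      have a2 := mem ((k + 1 : ℕ) / n) (by positivity)
        ((div_le_one hn0).2 (by push_cast; linarith))
      refine hP _ _ a1.1 a1.2 a2.1 a2.2 ?_ (ih (by omega))
      have e : x + ((k + 1 : ℕ) : ℝ) / n * (z - x) - (x + k / n * (z - x)) = (z - x) / n := by
        push_cast
        ring
      rw [e, abs_div, abs_of_pos hn0, div_lt_iff₀ hn0]
      linarith
  have := key n le_rfl
  rw [div_self hn0.ne'] at this
  simpa using this

/-- After a small move the old location keeps her best facility strictly between `a` and `c`, where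
only her own location is possible. -/
theorem wins_of_win (hw : MiddleWins F) {a b c : ℝ} (hab : a < b) (hbc : b < c)
    (hF : F a b c b) {b' : ℝ} (hab' : a < b') (hbc' : b' < c) : F a b' c b' := by
  refine forall_of_local (P := fun y => F a y c y) (u := min b b') (v := max b b')
    (m := min (min b b' - a) (c - max b b')) ?_ ?_ (min_le_left _ _) (le_max_left _ _)
    (min_le_right _ _) (le_max_right _ _) hF
  · exact lt_min (sub_pos.2 (lt_min hab hab')) (sub_pos.2 (max_lt hbc hbc'))
  · intro y y' h1 h2 h3 h4 h5 hy
    obtain ⟨l, hl⟩ := h.sp₂ a c y'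
    have h6 := (hl.2 y y hy).trans_lt h5
    have h7 := lt_min_iff.1 h6
    have h8 := lt_min hab hab'
    have h9 := max_lt hbc hbc'
    rw [abs_lt, abs_lt] at h7
    rcases h.outside_of_middleWins hw hl.1 with e | e | e
    · linarith
    · have := hl.1
      rwa [e] at this
    · linarith

theorem wins_of_wins_at (hw : MiddleWins F) {a c₀ : ℝ} (hac : a < c₀)
    (h₀ : ∀ b, a < b → b < c₀ → F a b c₀ b) {b c : ℝ} (hab : a < b) (hbc : b < c) :
    F a b c b := by
  have hK := h.nonneg
  -- Chosen so that `K * (1 - θ) < θ`: the middle agent at fraction `θ` of the way from `a` to `c₁`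
  -- then serves `c₁` best. Each step moves the right end inwards by almost the factor `θ`.
  set θ := (K + 2) / (K + 3) with hθ
  have hθ0 : 0 < θ := by positivity
  have hθ1 : θ < 1 := by
    rw [hθ, div_lt_one (by linarith)]
    linarith
  have step : ∀ c₁, a < c₁ → (∀ b, a < b → b < c₁ → F a b c₁ b) → ∀ c, θ * (c₁ - a) < c - a →
      ∀ b, a < b → b < c → F a b c b := by
    intro c₁ h1 h2 c h3 b h4 h5
    have h6 : 0 < θ * (c₁ - a) := mul_pos hθ0 (by linarith)
    have h7 : θ * (c₁ - a) < c₁ - a := mul_lt_of_lt_one_left (by linarith) hθ1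
    have h8 : a + θ * (c₁ - a) < c₁ := by linarith
    have h9 : K * (c₁ - (a + θ * (c₁ - a))) < a + θ * (c₁ - a) - a := by
      have e : θ * (K + 3) = K + 2 := by
        rw [hθ]
        field_simp
      have : K * (1 - θ) < θ := by nlinarith
      nlinarith
    have h10 := h.wins_right (by linarith) h8
      (h.best₃_of_close h8 h9 (h2 _ (by linarith) h8)) _ c le_rfl (by linarith)
    exact h.wins_of_win hw (by linarith) (by linarith) h10 h4 h5
  have all : ∀ n : ℕ, ∀ c, θ ^ n * (c₀ - a) < c - a → ∀ b, a < b → b < c → F a b c b := by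
    intro n
    induction n with
    | zero =>
      intro c hc
      refine step c₀ hac h₀ c ?_
      have : θ * (c₀ - a) < c₀ - a := mul_lt_of_lt_one_left (by linarith) hθ1
      simp at hc
      linarith
    | succ n ih =>
      intro c hc
      have h1 : θ ^ n * (c₀ - a) < (c - a) / θ := by
        rw [lt_div_iff₀ hθ0]
        rw [pow_succ] at hc
        linarith
      obtain ⟨r, hr1, hr2⟩ := exists_between h1
      have hr0 : 0 < r := lt_trans (mul_pos (pow_pos hθ0 _) (by linarith)) hr1
      rw [lt_div_iff₀ hθ0] at hr2
      have e : a + r - a = r := by ring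
      exact step (a + r) (by linarith) (ih _ (by linarith)) c (by rw [e]; linarith)
  obtain ⟨n, hn⟩ := exists_pow_lt_of_lt_one (show 0 < (c - a) / (c₀ - a) from
    div_pos (by linarith) (by linarith)) hθ1
  rw [lt_div_iff₀ (by linarith)] at hn
  exact all n c hn b hab hbc

/-- If the middle agent wins once, then she wins in all instances with the same order. -/
theorem wins_of_middleWins (hw : MiddleWins F) {a b c : ℝ} (hab : a < b) (hbc : b < c) :
    F a b c b := by
  obtain ⟨a₀, b₀, c₀, h1, h2, h3⟩ := id hw
  have r1 : ∀ b c, a₀ < b → b < c → F a₀ b c b := fun b c hb hc =>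
    h.wins_of_wins_at hw (h1.trans h2) (fun b' h4 h5 => h.wins_of_win hw h1 h2 h3 h4 h5) hb hc
  have left : ∀ a₁ c₁, a₁ < c₁ → (∀ b, a₁ < b → b < c₁ → F a₁ b c₁ b) →
      ∀ a b, a < b → b < c₁ → F a b c₁ b := by
    intro a₁ c₁ h4 h5 a b h6 h7
    have := h.reflect₃.wins_of_wins_at (middleWins_reflect₃ hw) (a := -c₁) (c₀ := -a₁)
      (by linarith) (fun b h8 h9 => by
        simpa [TwoFacility.reflect₃] using h5 (-b) (by linarith) (by linarith))
      (b := -b) (c := -a) (by linarith) (by linarith)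
    simpa [TwoFacility.reflect₃] using this
  -- Route of the outer agents: right end to `c₁`, left end from `a₀` to `a`, right end back to `c`.
  set c₁ := max c a₀ + 1 with hc1
  have h4 : c < c₁ := by linarith [le_max_left c a₀]
  have h5 : a₀ < c₁ := by linarith [le_max_right c a₀]
  exact h.wins_of_wins_at hw (hab.trans (hbc.trans h4))
    (fun b h6 h7 => left a₀ c₁ h5 (fun b h8 h9 => r1 b c₁ h8 h9) a b h6 h7) hab hbc

/-- No facility lies strictly between the outer agents, since the middle agent could move there and
win. So the left agent is never served from her right before reaching `b`. -/
theorem left_of_not_middleWins (hw : ¬ MiddleWins F) {a b c : ℝ} (hab : a < b) (hbc : b < c) :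
    F a b c a := by
  have out : ∀ {x y}, x < b → F x b c y → y ≤ x ∨ c ≤ y := by
    intro x y hx hy
    by_contra! hc
    exact hw ⟨x, y, c, hc.1, hc.2, (h.sp₂ x c).win hy⟩
  refine (h.sp₁ b c).available_left hab.le (h.eq_of_ratio_zero (by simp) (by simp)) ?_
  intro y hy1 hy2 l hl
  rcases eq_or_lt_of_le hy2 with rfl | hyb
  · have := hl.2 y y (h.eq_of_ratio_zero (by simp) (by simp))
    rw [sub_self, abs_zero] at this
    exact (sub_eq_zero.1 (abs_nonpos_iff.1 this)).ge
  · rcases out hyb hl.1 with e | e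
    · exact e
    · linarith [h.le_of_best₁ hyb hl]

theorem right_of_not_middleWins (hw : ¬ MiddleWins F) {a b c : ℝ} (hab : a < b) (hbc : b < c) :
    F a b c c := by
  have := h.reflect₃.left_of_not_middleWins (fun h' => hw (by
    obtain ⟨a, b, c, h1, h2, h3⟩ := h'
    exact ⟨-c, -b, -a, by linarith, by linarith, h3⟩))
    (a := -c) (b := -b) (c := -a) (by linarith) (by linarith)
  simpa [TwoFacility.reflect₃] using this

end IsNice₃

/-! ### From mechanisms to groups of agents -/

theorem cost_eq (p : ℝ × ℝ) (z : ℝ) : cost p z = min |z - p.1| |z - p.2| := by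
  rw [cost, Real.dist_eq, Real.dist_eq, abs_sub_comm p.1, abs_sub_comm p.2]

theorem cost_nonneg (p : ℝ × ℝ) (z : ℝ) : 0 ≤ cost p z := by
  rw [cost_eq]
  positivity

theorem cost_le_of_mem {p : ℝ × ℝ} {y : ℝ} (hy : y ∈ facilities p) (z : ℝ) :
    cost p z ≤ |z - y| := by
  rw [cost_eq]
  rcases hy with rfl | rfl
  · exact min_le_left _ _
  · exact min_le_right _ _

theorem exists_mem_cost_eq (p : ℝ × ℝ) (z : ℝ) : ∃ y ∈ facilities p, |z - y| = cost p z := by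
  rw [cost_eq]
  rcases min_choice |z - p.1| |z - p.2| with e | e
  · exact ⟨p.1, Or.inl rfl, e.symm⟩
  · exact ⟨p.2, Or.inr rfl, e.symm⟩

theorem eq_of_mem_facilities {p : ℝ × ℝ} {x y z : ℝ} (hx : x ∈ facilities p)
    (hy : y ∈ facilities p) (hz : z ∈ facilities p) : x = y ∨ x = z ∨ y = z := by
  rcases hx with rfl | rfl <;> rcases hy with rfl | rfl <;> rcases hz with rfl | rfl <;> simp

variable {n : ℕ} {f : Mechanism n}

/-- Agents at a common location cannot gain by a joint deviation. -/
theorem IsStrategyProof.coalition (hf : IsStrategyProof f) (S : Finset (Fin n)) {y : ℝ} :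
    ∀ {x x' : Profile n}, (∀ i ∈ S, x i = y) → (∀ i ∉ S, x' i = x i) →
      cost (f x) y ≤ cost (f x') y := by
  induction S using Finset.induction_on with
  | empty =>
    intro x x' _ h
    have : x' = x := funext fun i => h i (by simp)
    rw [this]
  | insert i S hi ih =>
    intro x x' h1 h2
    have h3 := hf x i (x' i)
    rw [h1 i (by simp)] at h3
    refine h3.trans (ih (fun j hj => ?_) fun j hj => ?_)
    · rw [Function.update_of_ne (by rintro rfl; exact hi hj)]
      exact h1 j (by simp [hj])
    · rcases eq_or_ne j i with rfl | hji
      · simp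
      · rw [Function.update_of_ne hji]
        exact h2 j (by simp [hj, hji])

theorem IsStrategyProof.hasBest (hf : IsStrategyProof f) (S : Finset (Fin n)) (p : ℝ → Profile n)
    (h1 : ∀ t, ∀ i ∈ S, p t i = t) (h2 : ∀ s t, ∀ i ∉ S, p s i = p t i) :
    HasBest fun t y => y ∈ facilities (f (p t)) := by
  intro t
  obtain ⟨y, hy, he⟩ := exists_mem_cost_eq (f (p t)) t
  refine ⟨y, hy, fun t' z hz => ?_⟩
  rw [he]
  exact (hf.coalition S (h1 t) (h2 t' t)).trans (cost_le_of_mem hz t)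

/-- A facility remains in its place when agents move to it. -/
theorem IsStrategyProof.mem_of_moves (hf : IsStrategyProof f) {x x' : Profile n} {y : ℝ}
    (hy : y ∈ facilities (f x)) (h : ∀ i, x' i = x i ∨ x' i = y) : y ∈ facilities (f x') := by
  have h0 : cost (f x) y ≤ 0 := by simpa using cost_le_of_mem hy y
  have h1 : cost (f x') y ≤ cost (f x) y :=
    hf.coalition (Finset.univ.filter fun i => x' i = y) (by simp) (by
      intro i hi
      simp only [Finset.mem_filter, Finset.mem_univ, true_and] at hi
      exact ((h i).resolve_right hi).symm)
  obtain ⟨z, hz, he⟩ := exists_mem_cost_eq (f x') y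
  have : y = z := sub_eq_zero.1 (abs_nonpos_iff.1 (by linarith))
  rwa [this]

theorem HasBoundedRatio.exists_bound (hf : HasBoundedRatio f) :
    ∃ K : ℝ, 0 ≤ K ∧ ∀ (x : Profile n) (p : ℝ × ℝ) (D : ℝ), (∀ i, cost p (x i) ≤ D) →
      ∀ i, ∃ y ∈ facilities (f x), |x i - y| ≤ K * D := by
  obtain ⟨γ, hγ⟩ := hf
  refine ⟨|γ| * n, by positivity, fun x p D hD i => ?_⟩
  obtain ⟨y, hy, he⟩ := exists_mem_cost_eq (f x) (x i)
  refine ⟨y, hy, ?_⟩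
  rw [he]
  have hs : ∀ q : ℝ × ℝ, 0 ≤ socialCost q x := fun q =>
    Finset.sum_nonneg fun j _ => cost_nonneg _ _
  have h1 : cost (f x) (x i) ≤ socialCost (f x) x :=
    Finset.single_le_sum (f := fun j => cost (f x) (x j)) (fun j _ => cost_nonneg _ _)
      (Finset.mem_univ i)
  have h2 : OPT x ≤ socialCost p x :=
    ciInf_le ⟨0, by rintro _ ⟨q, rfl⟩; exact hs q⟩ p
  have h3 : 0 ≤ OPT x := le_ciInf hs
  have h4 : socialCost p x ≤ n * D := by
    calc socialCost p x ≤ ∑ _j : Fin n, D := Finset.sum_le_sum fun j _ => hD j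
      _ = n * D := by simp
  calc cost (f x) (x i) ≤ γ * OPT x := h1.trans (hγ x)
    _ ≤ |γ| * OPT x := mul_le_mul_of_nonneg_right (le_abs_self γ) h3
    _ ≤ |γ| * (n * D) := mul_le_mul_of_nonneg_left (h2.trans h4) (abs_nonneg γ)
    _ = |γ| * n * D := by ring

/-- The profile with the agents of `A` at `a`, those of `C` at `c`, and the others at `b`. -/
def profile₃ (A C : Finset (Fin n)) (a b c : ℝ) : Profile n := fun i =>
  if i ∈ A then a else if i ∈ C then c else b

/-- The three agent mechanism induced by `f` when the agents move in the groups `A`, `(A ∪ C)ᶜ`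
and `C`. -/
def grouped (f : Mechanism n) (A C : Finset (Fin n)) (a b c y : ℝ) : Prop :=
  y ∈ facilities (f (profile₃ A C a b c))

theorem IsNice.exists_isNice₃ (hf : IsNice f) : ∃ K, ∀ A C : Finset (Fin n), A.Nonempty →
    C.Nonempty → (A ∪ C)ᶜ.Nonempty → Disjoint A C → IsNice₃ (grouped f A C) K := by
  obtain ⟨K, hK, hb⟩ := hf.boundedRatio.exists_bound
  refine ⟨K, fun A C hA hC hB hd => ?_⟩
  have hCA : ∀ i ∈ C, i ∉ A := fun i hi hi' => Finset.disjoint_left.1 hd hi' hi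
  constructor
  · exact hK
  · exact fun b c => hf.strategyProof.hasBest A (fun a => profile₃ A C a b c)
      (fun t i hi => by simp [profile₃, hi]) (fun s t i hi => by simp [profile₃, hi])
  · exact fun a c => hf.strategyProof.hasBest (A ∪ C)ᶜ (fun b => profile₃ A C a b c)
      (fun t i hi => by
        simp only [Finset.mem_compl, Finset.mem_union, not_or] at hi
        simp [profile₃, hi])
      (fun s t i hi => by
        simp only [Finset.mem_compl, Finset.mem_union, not_not] at hi
        by_cases h : i ∈ A
        · simp [profile₃, h]
        · simp [profile₃, h, hi.resolve_left h])
  · exact fun a b => hf.strategyProof.hasBest C (fun c => profile₃ A C a b c)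
      (fun t i hi => by simp [profile₃, hi, hCA i hi])
      (fun s t i hi => by simp [profile₃, hi])
  · exact eq_of_mem_facilities
  · intro a b c z hz
    have hmem : ∃ i, profile₃ A C a b c i = z := by
      rcases hz with rfl | rfl | rfl
      · obtain ⟨i, hi⟩ := hA
        exact ⟨i, by simp [profile₃, hi]⟩
      · obtain ⟨i, hi⟩ := hB
        simp only [Finset.mem_compl, Finset.mem_union, not_or] at hi
        exact ⟨i, by simp [profile₃, hi]⟩
      · obtain ⟨i, hi⟩ := hC
        exact ⟨i, by simp [profile₃, hi, hCA i hi]⟩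
    obtain ⟨i, rfl⟩ := hmem
    have key : ∀ p : ℝ × ℝ, ∀ D, cost p a ≤ D → cost p b ≤ D → cost p c ≤ D →
        cost (f (profile₃ A C a b c)) (profile₃ A C a b c i) ≤ K * D := by
      intro p D h1 h2 h3
      obtain ⟨y, hy, hle⟩ := hb (profile₃ A C a b c) p D (fun j => by
        unfold profile₃
        split_ifs <;> assumption) i
      exact (cost_le_of_mem hy _).trans hle
    obtain ⟨y, hy, he⟩ := exists_mem_cost_eq (f (profile₃ A C a b c)) (profile₃ A C a b c i)
    refine ⟨y, hy, ?_, ?_, ?_⟩ <;> rw [he]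
    · refine key (b, c) _ ?_ ?_ ?_ <;> simp [cost_eq]
    · refine key (a, c) _ ?_ ?_ ?_ <;> simp [cost_eq]
    · refine key (b, c) _ ?_ ?_ ?_ <;> simp [cost_eq]

/-! ### Groups that win in the middle -/

/-- In some instance with `A` to the left, `C` to the right and all others in the middle, the middle
gets a facility. -/
def GroupWins (f : Mechanism n) (A C : Finset (Fin n)) : Prop := MiddleWins (grouped f A C)

/-- The agents leaving `A` and `C` move onto the winning facility, which stays. -/
theorem GroupWins.mono (hf : IsNice f) {A A' C C' : Finset (Fin n)} (h : GroupWins f A C)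
    (hd : Disjoint A C) (hA : A' ⊆ A) (hC : C' ⊆ C) : GroupWins f A' C' := by
  obtain ⟨a, b, c, hab, hbc, hF⟩ := h
  refine ⟨a, b, c, hab, hbc, hf.strategyProof.mem_of_moves hF fun i => ?_⟩
  have h1 := @hA i
  have h2 := @hC i
  have h3 := fun h : i ∈ A => Finset.disjoint_left.1 hd h
  by_cases i ∈ A' <;> by_cases i ∈ C' <;> simp_all [profile₃]

theorem groupWins_of_mem (hf : IsNice f) {x : Profile n} {l : ℝ} (hl : l ∈ facilities (f x))
    {i k : Fin n} (hi : x i < l) (hk : l < x k) : GroupWins f {i} {k} := by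
  refine ⟨x i, l, x k, hi, hk, hf.strategyProof.mem_of_moves hl fun j => ?_⟩
  unfold profile₃
  split_ifs with h1 h2
  · rw [Finset.mem_singleton] at h1
    simp [h1]
  · rw [Finset.mem_singleton] at h2
    simp [h2]
  · simp

theorem GroupWins.not_rest_right (hf : IsNice f) {A C : Finset (Fin n)} (hA : A.Nonempty)
    (hC : C.Nonempty) (hB : (A ∪ C)ᶜ.Nonempty) (hd : Disjoint A C) (h : GroupWins f A C) :
    ¬ GroupWins f A (A ∪ C)ᶜ := by
  obtain ⟨K, hK⟩ := hf.exists_isNice₃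
  have e : swapLast (grouped f A C) = grouped f A (A ∪ C)ᶜ := by
    funext a b c y
    have : profile₃ A C a c b = profile₃ A (A ∪ C)ᶜ a b c := by
      funext i
      by_cases h1 : i ∈ A <;> by_cases h2 : i ∈ C <;> simp [profile₃, h1, h2]
    simp only [swapLast, grouped, this]
  rw [GroupWins, ← e]
  exact (hK A C hA hC hB hd).not_middleWins_swapLast h

theorem GroupWins.not_rest_left (hf : IsNice f) {A C : Finset (Fin n)} (hA : A.Nonempty)
    (hC : C.Nonempty) (hB : (A ∪ C)ᶜ.Nonempty) (hd : Disjoint A C) (h : GroupWins f A C) :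
    ¬ GroupWins f (A ∪ C)ᶜ C := by
  obtain ⟨K, hK⟩ := hf.exists_isNice₃
  have hCA : ∀ i ∈ C, i ∉ A := fun i hi hi' => Finset.disjoint_left.1 hd hi' hi
  have e : swapFirst (grouped f A C) = grouped f (A ∪ C)ᶜ C := by
    funext a b c y
    have : profile₃ A C b a c = profile₃ (A ∪ C)ᶜ C a b c := by
      funext i
      have := hCA i
      by_cases h1 : i ∈ A <;> by_cases h2 : i ∈ C <;> simp_all [profile₃]
    simp only [swapFirst, grouped, this]
  rw [GroupWins, ← e]
  exact (hK A C hA hC hB hd).not_middleWins_swapFirst h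

/-! ### Four groups and splitting -/

/-- One win of `u` would persist for all `c > u`; with the other facility at most `t`, a distant `c`
would exceed the bound `B`, which does not depend on `c`. -/
theorem never_wins {G : ℝ → ℝ → ℝ → Prop} {t : ℝ}
    (hU : ∀ c, HasBest fun u => G u c) (hC : ∀ u, HasBest (G u))
    (two : ∀ {u c x y z}, G u c x → G u c y → G u c z → x = y ∨ x = z ∨ y = z)
    (diag : ∀ {u}, t < u → G u u u)
    (left : ∀ {u c}, t < u → u < c → ∃ y, y ≤ t ∧ G u c y)
    (bound : ∀ {u}, t < u → ∃ B, ∀ c, u < c → ∃ y, G u c y ∧ |c - y| ≤ B)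
    {u c : ℝ} (htu : t < u) (huc : u < c) : ¬ G u c u := by
  intro hw
  have hb : Best (G u) c u := by
    obtain ⟨l, hl⟩ := hC u c
    have h1 := hl.2 u u (diag htu)
    rw [abs_of_pos (by linarith : 0 < c - u), abs_le] at h1
    obtain ⟨y, hy, hyG⟩ := left htu huc
    rcases two hyG hw hl.1 with e | e | e
    · linarith
    · linarith
    · rwa [← e] at hl
  have hall := wins_of_wins one_pos hU hC two diag
    (fun h1 h2 => by
      obtain ⟨y, hy, hyG⟩ := left h1 h2
      exact ⟨y, by linarith, hyG⟩)
    (fun h1 h2 h3 => by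
      obtain ⟨y, hy, hyG⟩ := left h1 h2
      exact ⟨y, hyG, by linarith⟩) htu huc hb u
  obtain ⟨B, hB⟩ := bound htu
  have h0 : u < u + |B| + 1 := by linarith [abs_nonneg B]
  obtain ⟨y, hy, hle⟩ := hB _ h0
  obtain ⟨y', hy', hyG⟩ := left htu h0
  rw [abs_le] at hle
  have := le_abs_self B
  rcases two hyG (hall _ le_rfl h0) hy with e | e | e <;> linarith

/-- In a strategy-proof four agent mechanism with these properties the two inner agents would both
never win, yet nearby inner agents have to win against each other. -/
theorem false_of_four_agents {H : ℝ → ℝ → ℝ → ℝ → ℝ → Prop} {K : ℝ}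
    (sA : ∀ t u c, HasBest fun a => H a t u c) (sT : ∀ a u c, HasBest fun t => H a t u c)
    (sU : ∀ a t c, HasBest fun u => H a t u c) (sC : ∀ a t u, HasBest (H a t u))
    (two : ∀ {a t u c x y z}, H a t u c x → H a t u c y → H a t u c z → x = y ∨ x = z ∨ y = z)
    (left1 : ∀ {t u c}, t < u → u < c → H t t u c t)
    (right2 : ∀ {a t u}, a < t → t < u → H a t u u u)
    (mid3 : ∀ {a b c}, a < b → b < c → H a b b c b)
    (bC : ∀ {a t u c}, a < t → t < u → u < c → ∃ y, H a t u c y ∧ |c - y| ≤ K * (u - a))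
    (bA : ∀ {a t u c}, a < t → t < u → u < c → ∃ y, H a t u c y ∧ |a - y| ≤ K * (c - t)) :
    False := by
  have yl : ∀ {a t u c}, a < t → t < u → u < c → ∃ y, y ≤ t ∧ H a t u c y := by
    intro a t u c h1 h2 h3
    obtain ⟨y, hy⟩ := sA t u c a
    have := hy.2 t t (left1 h2 h3)
    rw [abs_of_neg (by linarith : a - t < 0), abs_le] at this
    exact ⟨y, by linarith, hy.1⟩
  have yr : ∀ {a t u c}, a < t → t < u → u < c → ∃ y, u ≤ y ∧ H a t u c y := by
    intro a t u c h1 h2 h3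
    obtain ⟨y, hy⟩ := sC a t u c
    have := hy.2 u u (right2 h1 h2)
    rw [abs_of_pos (by linarith : 0 < c - u), abs_le] at this
    exact ⟨y, by linarith, hy.1⟩
  have noU : ∀ {a t u c}, a < t → t < u → u < c → ¬ H a t u c u := by
    intro a t u c h1 h2 h3
    refine never_wins (G := H a t) (sU a t) (sC a t) two (right2 h1) (yl h1) ?_ h2 h3
    intro u hu
    exact ⟨K * (u - a), fun c huc => bC h1 hu huc⟩
  have noT : ∀ {a t u c}, a < t → t < u → u < c → ¬ H a t u c t := by
    intro a t u c h1 h2 h3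
    have := never_wins (G := fun t' a' y' => H (-a') (-t') u c (-y')) (t := -u)
      (fun a' => (sT (-a') u c).reflect) (fun t' => (sA (-t') u c).reflect)
      (fun h1 h2 h3 => by simpa [neg_inj] using two h1 h2 h3)
      (fun {t'} h => left1 (by linarith) h3)
      (fun {t' a'} h4 h5 => by
        obtain ⟨y, hy, hyH⟩ := yr (a := -a') (t := -t') (u := u) (c := c) (by linarith)
          (by linarith) h3
        exact ⟨-y, by linarith, by rwa [neg_neg]⟩)
      (fun {t'} ht' => by
        refine ⟨K * (c + t'), fun a' ha' => ?_⟩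
        obtain ⟨y, hy, hle⟩ := bA (a := -a') (t := -t') (by linarith) (by linarith) h3
        refine ⟨-y, by rwa [neg_neg], ?_⟩
        rw [sub_neg_eq_add] at hle
        rwa [← abs_neg_sub_neg', neg_neg])
      (u := -t) (c := -a) (by linarith) (by linarith)
    simpa using this
  -- The agent at 1 could join the one at 3/2, so her best `m` is within 1/2. One facility is at
  -- most 1 and one at least 3/2, so `m = 3 / 2`, where `u` wins, or `m ≤ 1`, where `t` wins after
  -- moving to `m`.
  obtain ⟨m, hm⟩ := sT 0 (3 / 2) 3 1
  have h1 := hm.2 (3 / 2) (3 / 2) (mid3 (by norm_num) (by norm_num))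
  obtain ⟨y, hy, hyH⟩ := yl (a := 0) (t := 1) (u := 3 / 2) (c := 3) (by norm_num) (by norm_num)
    (by norm_num)
  obtain ⟨y', hy', hyH'⟩ := yr (a := 0) (t := 1) (u := 3 / 2) (c := 3) (by norm_num)
    (by norm_num) (by norm_num)
  rw [abs_of_neg (by norm_num : (1 : ℝ) - 3 / 2 < 0), abs_le] at h1
  have hcase : m ≤ 1 ∨ m = 3 / 2 := by
    rcases two hyH hyH' hm.1 with e | e | e
    · linarith
    · left; linarith
    · right; linarith
  rcases hcase with h2 | h2
  · exact noT (by linarith) (by linarith) (by norm_num) ((sT 0 (3 / 2) 3).win hm.1)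
  · exact noU (a := 0) (t := 1) (u := 3 / 2) (c := 3) (by norm_num) (by norm_num) (by norm_num)
      (h2 ▸ hm.1)

/-- The profile with `A` at `a`, `T` at `t`, `C` at `c`, and all others at `u`. -/
def profile₄ (A T C : Finset (Fin n)) (a t u c : ℝ) : Profile n := fun i =>
  if i ∈ A then a else if i ∈ T then t else if i ∈ C then c else u

/-- If the middle group wins, then one of its two parts wins when the other part joins the outer
group on its side. -/
theorem GroupWins.split (hf : IsNice f) {A T C : Finset (Fin n)} (hA : A.Nonempty)
    (hT : T.Nonempty) (hC : C.Nonempty) (hU : (A ∪ T ∪ C)ᶜ.Nonempty) (hAT : Disjoint A T)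
    (hAC : Disjoint A C) (hTC : Disjoint T C) (h : GroupWins f A C) :
    GroupWins f (A ∪ T) C ∨ GroupWins f A (A ∪ T)ᶜ := by
  by_contra! hn
  obtain ⟨K, hK⟩ := hf.exists_isNice₃
  obtain ⟨K', -, hb⟩ := hf.boundedRatio.exists_bound
  set H : ℝ → ℝ → ℝ → ℝ → ℝ → Prop := fun a t u c y =>
    y ∈ facilities (f (profile₄ A T C a t u c)) with hH
  have mem : ∀ i, (i ∈ A ∧ i ∉ T ∧ i ∉ C) ∨ (i ∉ A ∧ i ∈ T ∧ i ∉ C) ∨ (i ∉ A ∧ i ∉ T ∧ i ∈ C) ∨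
      (i ∉ A ∧ i ∉ T ∧ i ∉ C) := by
    intro i
    have h1 := fun h : i ∈ A => Finset.disjoint_left.1 hAT h
    have h2 := fun h : i ∈ A => Finset.disjoint_left.1 hAC h
    have h3 := fun h : i ∈ T => Finset.disjoint_left.1 hTC h
    tauto
  have e1 : ∀ t u c, profile₃ (A ∪ T) C t u c = profile₄ A T C t t u c := by
    intro t u c
    funext i
    rcases mem i with h | h | h | h <;> simp [profile₃, profile₄, h]
  have e2 : ∀ a t u, profile₃ A (A ∪ T)ᶜ a t u = profile₄ A T C a t u u := by
    intro a t u
    funext i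
    rcases mem i with h | h | h | h <;> simp [profile₃, profile₄, h]
  have e3 : ∀ a b c, profile₃ A C a b c = profile₄ A T C a b b c := by
    intro a b c
    funext i
    rcases mem i with h | h | h | h <;> simp [profile₃, profile₄, h]
  have n1 := hK (A ∪ T) C (hA.mono Finset.subset_union_left) hC hU
    (Finset.disjoint_union_left.2 ⟨hAC, hTC⟩)
  have n2 := hK A (A ∪ T)ᶜ hA (hU.mono (Finset.compl_subset_compl.2 Finset.subset_union_left))
    (by
      obtain ⟨i, hi⟩ := hT
      refine ⟨i, ?_⟩
      have := fun h : i ∈ A => Finset.disjoint_left.1 hAT h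
      simp
      tauto)
    (Finset.disjoint_left.2 fun i hi => by simp [hi])
  have n3 := hK A C hA hC (by
      obtain ⟨i, hi⟩ := hT
      refine ⟨i, ?_⟩
      have := fun h : i ∈ A => Finset.disjoint_left.1 hAT h
      have := fun h : i ∈ T => Finset.disjoint_left.1 hTC h
      simp
      tauto) hAC
  have left1 : ∀ {t u c}, t < u → u < c → H t t u c t := fun h1 h2 => by
    have := n1.left_of_not_middleWins hn.1 h1 h2
    rwa [grouped, e1] at this
  have right2 : ∀ {a t u}, a < t → t < u → H a t u u u := fun h1 h2 => by
    have := n2.right_of_not_middleWins hn.2 h1 h2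
    rwa [grouped, e2] at this
  have mid3 : ∀ {a b c}, a < b → b < c → H a b b c b := fun h1 h2 => by
    have := n3.wins_of_middleWins h h1 h2
    rwa [grouped, e3] at this
  have pC : ∀ a t u c, ∀ i ∈ C, profile₄ A T C a t u c i = c := fun a t u c i hi => by
    simp [profile₄, hi, Finset.disjoint_right.1 hAC hi, Finset.disjoint_right.1 hTC hi]
  have sA : ∀ t u c, HasBest fun a => H a t u c := fun t u c =>
    hf.strategyProof.hasBest A (fun a => profile₄ A T C a t u c)
      (fun s i hi => by simp [profile₄, hi]) (fun s s' i hi => by simp [profile₄, hi])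
  have sT : ∀ a u c, HasBest fun t => H a t u c := fun a u c =>
    hf.strategyProof.hasBest T (fun t => profile₄ A T C a t u c)
      (fun s i hi => by simp [profile₄, hi, Finset.disjoint_right.1 hAT hi])
      (fun s s' i hi => by simp [profile₄, hi])
  have sC : ∀ a t u, HasBest (H a t u) := fun a t u =>
    hf.strategyProof.hasBest C (fun c => profile₄ A T C a t u c)
      (fun s i hi => pC _ _ _ _ i hi)
      (fun s s' i hi => by simp [profile₄, hi])
  have sU : ∀ a t c, HasBest fun u => H a t u c := fun a t c =>
    hf.strategyProof.hasBest (A ∪ T ∪ C)ᶜ (fun u => profile₄ A T C a t u c)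
      (fun s i hi => by
        simp only [Finset.mem_compl, Finset.mem_union, not_or] at hi
        simp [profile₄, hi])
      (fun s s' i hi => by
        simp only [Finset.mem_compl, Finset.mem_union, not_not] at hi
        rcases mem i with h | h | h | h
        · simp [profile₄, h]
        · simp [profile₄, h]
        · simp [profile₄, h]
        · tauto)
  have two : ∀ {a t u c x y z}, H a t u c x → H a t u c y → H a t u c z →
      x = y ∨ x = z ∨ y = z := eq_of_mem_facilities
  have cost_le : ∀ {a t u c D}, |t - a| ≤ D ∧ |u - a| ≤ D ∨ |t - c| ≤ D ∧ |u - c| ≤ D →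
      ∀ i, cost (a, c) (profile₄ A T C a t u c i) ≤ D := by
    intro a t u c D hD j
    have h0 : 0 ≤ D := by
      rcases hD with h | h <;> exact (abs_nonneg _).trans h.1
    rw [cost_eq, min_le_iff]
    rcases mem j with h | h | h | h <;> simp only [profile₄, h, if_true, if_false, sub_self,
      abs_zero, h0, true_or, or_true] <;> tauto
  refine false_of_four_agents (K := K') sA sT sU sC two left1 right2 mid3 ?_ ?_
  · intro a t u c h1 h2 h3
    obtain ⟨i, hi⟩ := hC
    obtain ⟨y, hy, hle⟩ := hb (profile₄ A T C a t u c) (a, c) (u - a) (cost_le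
      (Or.inl ⟨by rw [abs_of_pos] <;> linarith, by rw [abs_of_pos]; linarith⟩)) i
    refine ⟨y, hy, ?_⟩
    rwa [pC _ _ _ _ i hi] at hle
  · intro a t u c h1 h2 h3
    obtain ⟨i, hi⟩ := hA
    obtain ⟨y, hy, hle⟩ := hb (profile₄ A T C a t u c) (a, c) (c - t) (cost_le
      (Or.inr ⟨by rw [abs_of_neg] <;> linarith, by rw [abs_of_neg] <;> linarith⟩)) i
    refine ⟨y, hy, ?_⟩
    have : profile₄ A T C a t u c i = a := by
      simp [profile₄, hi]
    rwa [this] at hle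

/-! ### The pivot and the conclusion -/

/-- If a group wins between `{i}` and everybody else, then so does one of its members. -/
theorem exists_groupWins_singleton (hf : IsNice f) {i : Fin n} (B : Finset (Fin n)) :
    B.Nonempty → i ∉ B → ({i} ∪ B)ᶜ.Nonempty → GroupWins f {i} ({i} ∪ B)ᶜ →
      ∃ j ∈ B, GroupWins f {i} ({i, j} : Finset (Fin n))ᶜ := by
  induction B using Finset.strongInduction with
  | H B ih =>
    intro hB hi hC hw
    obtain ⟨j, hj⟩ := hB
    rcases eq_or_ne B {j} with rfl | hne
    · exact ⟨j, hj, hw⟩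
    have hU : (B.erase j).Nonempty := by
      rw [Finset.nonempty_iff_ne_empty, Ne, Finset.erase_eq_empty_iff]
      exact not_or.2 ⟨Finset.ne_empty_of_mem hj, hne⟩
    have hij : i ≠ j := fun h => hi (h ▸ hj)
    obtain ⟨k, hk⟩ := hC
    have hk' : k ≠ i ∧ k ∉ B := by simpa using hk
    set U := B.erase j with hUdef
    have hjU : j ∉ U := by simp [hUdef]
    have hiU : i ∉ U := fun h => hi (Finset.mem_of_mem_erase h)
    set C := ({i} ∪ B)ᶜ with hCdef
    have hCm : ∀ m, m ∈ C ↔ m ≠ i ∧ m ∉ B := fun m => by simp [hCdef]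
    have hBU : ∀ m, m ∈ B ↔ m = j ∨ m ∈ U := fun m => by
      rcases eq_or_ne m j with rfl | h <;> simp_all
    have eU : ({i} ∪ {j} ∪ C)ᶜ = U := by
      ext m
      simp only [Finset.mem_compl, Finset.mem_union, Finset.mem_singleton, hCm, hBU]
      by_cases h1 : m = i
      · simp [h1, hiU]
      · by_cases h2 : m = j
        · simp [h2, hjU]
        · tauto
    have ej : ({i} ∪ U ∪ C)ᶜ = {j} := by
      ext m
      simp only [Finset.mem_compl, Finset.mem_union, Finset.mem_singleton, hCm, hBU]
      by_cases h1 : m = i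
      · simp [h1, hij]
      · by_cases h2 : m = j
        · simp [h2, hij.symm, hjU]
        · tauto
    have dC : Disjoint {i} C := by simp [hCm]
    have djC : Disjoint {j} C := by simp [hCm, hj]
    have dUC : Disjoint U C := Finset.disjoint_left.2 fun m hm hm' =>
      ((hCm m).1 hm').2 (Finset.mem_of_mem_erase hm)
    rcases hw.split hf (T := U) ⟨i, by simp⟩ hU ⟨k, hk⟩ (by rw [ej]; simp) (by simpa using hiU)
      dC dUC with h1 | h1
    · rcases hw.split hf (T := {j}) ⟨i, by simp⟩ ⟨j, by simp⟩ ⟨k, hk⟩ (by rwa [eU])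
        (by simpa using hij) dC djC with h2 | h2
      -- Here `{j}` wins between `{i} ∪ U` and `C`, while shrinking `{i} ∪ {j}` to `{j}` makes `{i}
      -- ∪ U` win between `{j}` and `C`.
      · exfalso
        have h3 := h1.not_rest_left hf ⟨i, by simp⟩ ⟨k, hk⟩ (by rw [ej]; simp)
          (Finset.disjoint_union_left.2 ⟨dC, dUC⟩)
        rw [ej] at h3
        exact h3 (h2.mono hf (Finset.disjoint_union_left.2 ⟨dC, djC⟩)
          Finset.subset_union_right subset_rfl)
      · exact ⟨j, hj, h2⟩
    · obtain ⟨m, hm, h3⟩ := ih U (Finset.erase_ssubset hj) hU hiU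
        ⟨k, by simp [hk'.1, hUdef, hk'.2]⟩ h1
      exact ⟨m, Finset.mem_of_mem_erase hm, h3⟩

/-- If the group of all others wins between `{i}` and `{k}`, then there is an agent `j` such that no
group wins between `{i}` and `{j}`, or between `{j}` and `{k}`. -/
theorem exists_pivot (hf : IsNice f) {i k : Fin n} (hik : i ≠ k)
    (hM : ({i, k} : Finset (Fin n))ᶜ.Nonempty) (hw : GroupWins f {i} {k}) :
    ∃ j, ¬ GroupWins f {i} {j} ∧ ¬ GroupWins f {j} {k} := by
  have e : ({i} ∪ ({i, k} : Finset (Fin n))ᶜ)ᶜ = {k} := by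
    ext m
    rcases eq_or_ne m i with rfl | h1 <;> simp_all
  obtain ⟨j, hj, hwj⟩ := exists_groupWins_singleton hf (i := i) ({i, k} : Finset (Fin n))ᶜ hM (by simp)
    ⟨k, by simp [hik.symm]⟩ (by rwa [e])
  have hj' : j ≠ i ∧ j ≠ k := by simpa using hj
  have ej : ({i} ∪ ({i, j} : Finset (Fin n))ᶜ)ᶜ = {j} := by
    ext m
    rcases eq_or_ne m i with rfl | h1
    · simp [hj'.1.symm]
    · simp [h1]
  have n1 : ¬ GroupWins f {i} {j} := by
    have := hwj.not_rest_right hf ⟨i, by simp⟩ ⟨k, by simp [hik.symm, hj'.2.symm]⟩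
      (by rw [ej]; simp) (by simp)
    rwa [ej] at this
  refine ⟨j, n1, ?_⟩
  -- everybody but `j` and `k` cannot win against `{j}` from the left
  have hlast : GroupWins f ({j, k} : Finset (Fin n))ᶜ {k} := by
    rcases eq_or_ne ({j, k} : Finset (Fin n))ᶜ {i} with h1 | h1
    · rwa [h1]
    set U := (({i, j, k} : Finset (Fin n))ᶜ) with hU
    have eU : {i} ∪ U = ({j, k} : Finset (Fin n))ᶜ := by
      ext m
      rcases eq_or_ne m i with rfl | h2
      · simp [hj'.1.symm, hik]
      · simp [hU, h2]
    have hUne : U.Nonempty := by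
      rw [Finset.nonempty_iff_ne_empty]
      intro h0
      rw [h0, Finset.union_empty] at eU
      exact h1 eU.symm
    have e1 : ({i} ∪ U ∪ {k})ᶜ = {j} := by
      rw [eU]
      ext m
      rcases eq_or_ne m k with rfl | h2
      · simp [hj'.2.symm]
      · simp [h2]
    rcases hw.split hf (T := U) ⟨i, by simp⟩ hUne ⟨k, by simp⟩ (by rw [e1]; simp)
      (by simp [hU]) (by simpa using hik) (by simp [hU]) with h2 | h2
    · rwa [eU] at h2
    · refine absurd (h2.mono hf ?_ subset_rfl ?_) n1
      · rw [eU]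
        simp [hj'.1.symm, hik]
      · rw [eU]
        simp
  have e2 : (({j, k} : Finset (Fin n))ᶜ ∪ {k})ᶜ = {j} := by
    ext m
    rcases eq_or_ne m k with rfl | h2
    · simp [hj'.2.symm]
    · simp [h2]
  have := hlast.not_rest_left hf ⟨i, by simp [hj'.1.symm, hik]⟩ ⟨k, by simp⟩ (by rw [e2]; simp)
    (by simp)
  rwa [e2] at this

theorem compl_pair_nonempty (hn : 3 ≤ n) (i k : Fin n) : ({i, k} : Finset (Fin n))ᶜ.Nonempty := by
  rw [← Finset.card_pos, Finset.card_compl, Fintype.card_fin]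
  have := Finset.card_le_two (a := i) (b := k)
  omega

/-- There cannot be two different facilities strictly between some two agents. -/
theorem facilities_not_both_inside (hn : 3 ≤ n) (hf : IsNice f) {x : Profile n} {l r : ℝ}
    (hl : l ∈ facilities (f x)) (hr : r ∈ facilities (f x)) (hlr : l < r) {i k : Fin n}
    (hi : x i < l) (hk : r < x k) : False := by
  have hik : i ≠ k := by
    rintro rfl
    linarith
  obtain ⟨j, h1, h2⟩ := exists_pivot hf hik (compl_pair_nonempty hn i k)
    (groupWins_of_mem hf hl hi (hlr.trans hk))
  rcases lt_or_ge l (x j) with h | h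
  · exact h1 (groupWins_of_mem hf hl hi h)
  · exact h2 (groupWins_of_mem hf hr (by linarith) hk)

theorem not_groupWins_dictator_left (hn : 3 ≤ n) (hf : IsNice f) {j k : Fin n}
    (hj : IsDictator f j) (hjk : j ≠ k) : ¬ GroupWins f {j} {k} := by
  intro hw
  obtain ⟨K, hK⟩ := hf.exists_isNice₃
  have h3 := hK {j} {k} ⟨j, by simp⟩ ⟨k, by simp⟩ (compl_pair_nonempty hn j k) (by simpa using hjk)
  have hK0 := h3.nonneg
  -- The facilities are at 0 and 1, so the agent at `K + 2` is at distance `K + 1` from them, while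
  -- the ratio allows only `K`.
  have hm := h3.wins_of_middleWins hw (a := 0) (b := 1) (c := K + 2) (by norm_num) (by linarith)
  have h0 : grouped f {j} {k} 0 1 (K + 2) 0 := by
    simpa [grouped, profile₃] using hj (profile₃ {j} {k} 0 1 (K + 2))
  obtain ⟨y, hy, hle, -, -⟩ := h3.ratio 0 1 (K + 2) (K + 2) (by simp)
  have e : |(0 : ℝ) - 1| = 1 := by norm_num
  rw [e, abs_le] at hle
  rcases h3.two h0 hm hy with h | h | h <;> linarith

theorem not_groupWins_dictator_right (hn : 3 ≤ n) (hf : IsNice f) {i j : Fin n}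
    (hj : IsDictator f j) (hij : i ≠ j) : ¬ GroupWins f {i} {j} := by
  intro hw
  obtain ⟨K, hK⟩ := hf.exists_isNice₃
  have h3 := hK {i} {j} ⟨i, by simp⟩ ⟨j, by simp⟩ (compl_pair_nonempty hn i j) (by simpa using hij)
  have hK0 := h3.nonneg
  have hm := h3.wins_of_middleWins hw (a := -(K + 2)) (b := -1) (c := 0) (by linarith)
    (by norm_num)
  have h0 : grouped f {i} {j} (-(K + 2)) (-1) 0 0 := by
    simpa [grouped, profile₃, hij.symm] using hj (profile₃ {i} {j} (-(K + 2)) (-1) 0)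
  obtain ⟨y, hy, -, hle, -⟩ := h3.ratio (-(K + 2)) (-1) 0 (-(K + 2)) (by simp)
  have e : |(-1 : ℝ) - 0| = 1 := by norm_num
  rw [e, abs_le] at hle
  rcases h3.two h0 hm hy with h | h | h <;> linarith

end TwoFacility

theorem theorem1 (n : ℕ) (hn : 5 ≤ n) (f : TwoFacility.Mechanism n)
    (hf : TwoFacility.IsNice f) :
    (∀ x : TwoFacility.Profile n,
      (∃ l ∈ TwoFacility.facilities (f x), (⨆ i, x i) ≤ l ∨ l ≤ ⨅ i, x i) ∨
        (f x).1 = (f x).2) ∧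
    (∀ j : Fin n, TwoFacility.IsDictator f j →
      ∀ (x : TwoFacility.Profile n) (l₂ : ℝ), TwoFacility.facilities (f x) = {x j, l₂} →
        l₂ ≤ (⨅ i, x i) ∨ (⨆ i, x i) ≤ l₂ ∨ l₂ = x j) := by
  have : Nonempty (Fin n) := ⟨⟨0, by omega⟩⟩
  have hn3 : 3 ≤ n := by omega
  constructor
  · intro x
    obtain ⟨i, hi⟩ := exists_eq_ciInf_of_finite (f := x)
    obtain ⟨k, hk⟩ := exists_eq_ciSup_of_finite (f := x)
    by_contra! hc
    obtain ⟨h1, h2⟩ := hc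
    have m1 : (f x).1 ∈ TwoFacility.facilities (f x) := Or.inl rfl
    have m2 : (f x).2 ∈ TwoFacility.facilities (f x) := Or.inr rfl
    have b1 := h1 _ m1
    have b2 := h1 _ m2
    rw [← hi, ← hk] at b1 b2
    rcases lt_or_gt_of_ne h2 with h | h
    · exact TwoFacility.facilities_not_both_inside hn3 hf m1 m2 h b1.2 b2.1
    · exact TwoFacility.facilities_not_both_inside hn3 hf m2 m1 h b2.2 b1.1
  · intro j hj x l₂ he
    obtain ⟨i, hi⟩ := exists_eq_ciInf_of_finite (f := x)
    obtain ⟨k, hk⟩ := exists_eq_ciSup_of_finite (f := x)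
    by_contra! hc
    obtain ⟨h1, h2, h3⟩ := hc
    rw [← hi] at h1
    rw [← hk] at h2
    have hl : l₂ ∈ TwoFacility.facilities (f x) := by simp [he]
    rcases lt_or_gt_of_ne h3 with h | h
    · exact TwoFacility.not_groupWins_dictator_right hn3 hf hj
        (by rintro rfl; linarith) (TwoFacility.groupWins_of_mem hf hl h1 h)
    · exact TwoFacility.not_groupWins_dictator_left hn3 hf hj
        (by rintro rfl; linarith) (TwoFacility.groupWins_of_mem hf hl h h2)
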